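/- Let $\mathsf G=(V,\mathsf E)$ be a finite non-empty connected bidirected graph: a finite directed multigraph with source and target maps $s,t:\mathsf E\to V$ (multiple edges and self-loops are allowed), together with a fixed-point-free involution $e\mapsto e^{-1}$ of $\mathsf E$ such that $s(e^{-1})=t(e)$ and $t(e^{-1})=s(e)$, and such that any two vertices are joined by a path. Let $p=|V|$, and let $(x_e)_{e\in\mathsf E}$ be positive real weights with $x_{e^{-1}}=x_e$. Let $N\ge 0$ be an integer and, for every $e\in\mathsf E$, let $U_e\in \mathrm U_N(\mathbb C)$ be a unitary matrix, with $U_{e^{-1}}=U_e^{-1}$. Define the twisted Laplacian $\Delta$ on $\prod_{v\in V}\mathbb C^N$ and the scalar Laplacian $\Delta_0$ on $\mathbb C^V$ by $$\Delta f(v)=\sum_{e\in\mathsf E:\,s(e)=v}x_e\big[f(s(e))-U_e f(t(e))\big],\qquad \Delta_0 f(v)=\sum_{e\in\mathsf E:\,s(e)=v}x_e\big[f(s(e))-f(t(e))\big].$$ Then, counted with algebraic multiplicity, the eigenvalues of $\Delta$ are real numbers $\lambda_1\ge\dots\ge\lambda_{Np}\ge 0$, the eigenvalues of $\Delta_0$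 are real numbers $\mu_1\ge\dots\ge\mu_p$ with $\mu_p=0$ and $\mu_i>0$ for all $i<p$, and for every real $t\ge 0$ $$\det(t+\Delta)=\prod_{i=1}^{Np}(t+\lambda_i)\ \ge\ \prod_{i=1}^{p}(t+\mu_i)^N=\det(t+\Delta_0)^N .$$ -/

import Mathlib

section QuiverLaplacian

variable {V : Type*} [Fintype V] [Quiver V] [∀ u v : V, Fintype (u ⟶ v)]

/-- The twisted Laplacian of a finite quiver with edge weights `x` and a representation `U` of
constant rank `N`, acting on `∏_{v} ℂ ^ N`:
`(Δ f)(u) = ∑_{e : s(e) = u} x_e (f(u) - U_e f(t(e)))`.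
The edges with source `u` are listed according to their target `v`. -/
noncomputable def twistedLaplacian {N : ℕ} (x : ∀ ⦃u v : V⦄, (u ⟶ v) → ℝ)
    (U : ∀ ⦃u v : V⦄, (u ⟶ v) → Matrix (Fin N) (Fin N) ℂ) :
    (V → Fin N → ℂ) →ₗ[ℂ] (V → Fin N → ℂ) where
  toFun f u := ∑ v : V, ∑ e : u ⟶ v, (x e : ℂ) • (f u - (U e).mulVec (f v))
  map_add' f g := by
    funext u
    simp only [Pi.add_apply, Matrix.mulVec_add, ← Finset.sum_add_distrib, ← smul_add]
    refine Finset.sum_congr rfl fun v _ => Finset.sum_congr rfl fun e _ => ?_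
    congr 1
    abel
  map_smul' c f := by
    funext u
    simp only [Pi.smul_apply, Matrix.mulVec_smul, RingHom.id_apply, ← smul_sub, Finset.smul_sum]
    refine Finset.sum_congr rfl fun v _ => Finset.sum_congr rfl fun e _ => ?_
    rw [smul_comm]

/-- The classical weighted Laplacian, acting on functions on the vertices:
`(Δ₀ f)(u) = ∑_{e : s(e) = u} x_e (f(u) - f(t(e)))`. -/
noncomputable def scalarLaplacian (x : ∀ ⦃u v : V⦄, (u ⟶ v) → ℝ) :
    (V → ℂ) →ₗ[ℂ] (V → ℂ) where
  toFun f u := ∑ v : V, ∑ e : u ⟶ v, (x e : ℂ) * (f u - f v)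
  map_add' f g := by
    funext u
    simp only [Pi.add_apply, ← Finset.sum_add_distrib, ← mul_add]
    refine Finset.sum_congr rfl fun v _ => Finset.sum_congr rfl fun e _ => ?_
    ring
  map_smul' c f := by
    funext u
    simp only [Pi.smul_apply, smul_eq_mul, RingHom.id_apply, Finset.mul_sum]
    refine Finset.sum_congr rfl fun v _ => Finset.sum_congr rfl fun e _ => ?_
    ring

end QuiverLaplacian

/-- `l 0 ≥ l 1 ≥ …` is the complete list of eigenvalues of `T`, all of them real, repeated
according to their algebraic multiplicities. There is at most one such list. -/
def IsOrderedSpectrum {W : Type*} [AddCommGroup W] [Module ℂ W] [Module.Finite ℂ W]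
    (T : W →ₗ[ℂ] W) {n : ℕ} (l : Fin n → ℝ) : Prop :=
  Antitone l ∧ T.charpoly.roots = Finset.univ.val.map (fun i : Fin n => (l i : ℂ))

/-! Diamagnetic comparison. If `c` is at least every weighted degree, `c - Δ₀` has non-negative
entries, and `c - Δ` is the same matrix with each edge term multiplied by a unitary, so each of its
`N × N` blocks has operator norm at most the corresponding scalar entry. Expanding powers over
closed walks gives `|tr (c - Δ)^n| ≤ N tr (c - Δ₀)^n` (`Matrix.norm_trace_comp_pow_le`).

For `t > 0` and `c` also above both spectra, dividing by `n (c + t)^n` and summing over `n ≥ 1`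
turns these traces into `-log det ((t + Δ) / (c + t))` and its scalar analogue; the powers of `c +
t` cancel (`prod_add_pow_le_prod_add`), and `t = 0` follows by continuity.

Edge reversal makes both operators Hermitian. Their quadratic forms are Dirichlet energies, whence
non-negativity and, by connectedness, a kernel of `Δ₀` consisting of the constants. -/

open Matrix

/-! ### Traces, determinants and spectra of Hermitian matrices -/

namespace Matrix.IsHermitian

variable {ι : Type*} [Fintype ι] [DecidableEq ι] {A : Matrix ι ι ℂ}

open Unitary in
theorem trace_smul_one_sub_pow (hA : A.IsHermitian) (c : ℝ) (n : ℕ) :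
    (((c : ℂ) • (1 : Matrix ι ι ℂ) - A) ^ n).trace = ((∑ i, (c - hA.eigenvalues i) ^ n : ℝ) : ℂ) := by
  have h : ((c : ℂ) • (1 : Matrix ι ι ℂ) - A) ^ n = conjStarAlgAut ℂ _ hA.eigenvectorUnitary
      (diagonal fun i => (c - hA.eigenvalues i : ℂ) ^ n) := by
    have h1 : (c : ℂ) • (1 : Matrix ι ι ℂ) - A = conjStarAlgAut ℂ _ hA.eigenvectorUnitary
        (diagonal fun i => (c - hA.eigenvalues i : ℂ)) := by
      have : (diagonal fun i => (c - hA.eigenvalues i : ℂ)) = (c : ℂ) • (1 : Matrix ι ι ℂ) -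
          diagonal (RCLike.ofReal ∘ hA.eigenvalues) := by
        rw [smul_one_eq_diagonal, diagonal_sub]
        rfl
      rw [this, map_sub, map_smul, map_one, ← hA.spectral_theorem]
    rw [h1, ← map_pow, diagonal_pow]
    rfl
  rw [h, conjStarAlgAut_apply, trace_mul_comm, ← mul_assoc]
  simp [trace_diagonal]

theorem det_smul_one_add (hA : A.IsHermitian) (t : ℝ) :
    ((t : ℂ) • (1 : Matrix ι ι ℂ) + A).det = ((∏ i, (t + hA.eigenvalues i) : ℝ) : ℂ) := by
  have h := A.eval_charpoly (-t : ℂ)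
  rw [hA.charpoly_eq, Polynomial.eval_prod] at h
  have h2 : (t : ℂ) • (1 : Matrix ι ι ℂ) + A = -(scalar ι (-t : ℂ) - A) := by
    rw [scalar_apply, ← smul_one_eq_diagonal]
    simp [add_comm]
  rw [h2, det_neg, ← h, ← Finset.card_univ, ← Finset.prod_const, ← Finset.prod_mul_distrib]
  push_cast
  refine Finset.prod_congr rfl fun i _ => ?_
  simp
  ring

/-- A linear map conjugate to a Hermitian matrix has an ordered real spectrum, which enumerates the
eigenvalues of the matrix. -/
theorem exists_isOrderedSpectrum (hA : A.IsHermitian) {n : ℕ} (hn : Fintype.card ι = n)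
    {W : Type*} [AddCommGroup W] [Module ℂ W] [Module.Finite ℂ W]
    {T : W →ₗ[ℂ] W} (hT : T.charpoly = A.charpoly) :
    ∃ (l : Fin n → ℝ) (e : Fin n ≃ ι), (∀ i, l i = hA.eigenvalues (e i)) ∧
      IsOrderedSpectrum T l := by
  subst hn
  refine ⟨hA.eigenvalues₀, Fintype.equivOfCardEq (Fintype.card_fin _), fun i => ?_,
    hA.eigenvalues₀_antitone, ?_⟩
  · simp [eigenvalues]
  · rw [hT, hA.roots_charpoly_eq_eigenvalues₀]
    rfl

end Matrix.IsHermitian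

/-! ### Block matrices dominated by a real matrix -/

section DominatedBlocks
open scoped Matrix.Norms.L2Operator

/-- A diagonal entry is a coordinate of the image of a unit basis vector. -/
theorem Matrix.norm_trace_le_card_mul_l2_opNorm {n : Type*} [Fintype n] [DecidableEq n]
    (M : Matrix n n ℂ) : ‖M.trace‖ ≤ Fintype.card n * ‖M‖ := by
  have key : ∀ i, ‖M i i‖ ≤ ‖M‖ := fun i => by
    have h := M.l2_opNorm_mulVec (EuclideanSpace.single i (1 : ℂ))
    have h' := PiLp.norm_apply_le ((EuclideanSpace.equiv n ℂ).symm
      (M *ᵥ (EuclideanSpace.single i (1 : ℂ)))) i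
    refine le_trans (le_of_eq ?_) (h'.trans (h.trans (le_of_eq ?_)))
    · simp
    · simp
  calc ‖M.trace‖ ≤ ∑ i, ‖M i i‖ := norm_sum_le _ _
    _ ≤ ∑ _i : n, ‖M‖ := Finset.sum_le_sum fun i _ => key i
    _ = _ := by simp

variable {V R : Type*} [Fintype V] [DecidableEq V]

/-- Triangle inequality and submultiplicativity along walks. The bound on `‖1‖` serves `n = 0`;
equality would fail for matrices of size zero. -/
theorem Matrix.norm_pow_apply_le [NormedRing R] {B : Matrix V V R} {b : Matrix V V ℝ}
    (h1 : ‖(1 : R)‖ ≤ 1) (h : ∀ u v, ‖B u v‖ ≤ b u v) (n : ℕ) (u v : V) :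
    ‖(B ^ n) u v‖ ≤ (b ^ n) u v := by
  induction n generalizing u v with
  | zero =>
    by_cases huv : u = v
    · simpa [one_apply, huv] using h1
    · simp [huv]
  | succ n ih =>
    rw [pow_succ, pow_succ, mul_apply, mul_apply]
    refine (norm_sum_le _ _).trans (Finset.sum_le_sum fun w _ => (norm_mul_le _ _).trans ?_)
    exact mul_le_mul (ih u w) (h w v) (norm_nonneg _) ((norm_nonneg _).trans (ih u w))

/-- The **diamagnetic inequality** for traces of powers of block matrices. -/
theorem Matrix.norm_trace_comp_pow_le {m : Type*} [Fintype m] [DecidableEq m]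
    {B : Matrix V V (Matrix m m ℂ)} {b : Matrix V V ℝ} (h : ∀ u v, ‖B u v‖ ≤ b u v) (n : ℕ) :
    ‖(comp V V m m ℂ B ^ n).trace‖ ≤ Fintype.card m * (b ^ n).trace := by
  have h1 : ‖(1 : Matrix m m ℂ)‖ ≤ 1 := by
    rw [← diagonal_one, l2_opNorm_diagonal]
    exact (pi_norm_le_iff_of_nonneg zero_le_one).2 fun i => by simp
  have h2 : (comp V V m m ℂ B ^ n).trace = ∑ u, ((B ^ n) u u).trace := by
    rw [← compRingEquiv_apply, ← map_pow, compRingEquiv_apply]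
    simp [trace, Fintype.sum_prod_type]
  rw [h2, trace, Finset.mul_sum]
  refine (norm_sum_le _ _).trans (Finset.sum_le_sum fun u _ => ?_)
  refine (norm_trace_le_card_mul_l2_opNorm _).trans ?_
  exact mul_le_mul_of_nonneg_left (norm_pow_apply_le h1 h n u u) (Nat.cast_nonneg _)

end DominatedBlocks

/-! ### From power sums to products -/

/-- If all power sums of `1 - a` are dominated by those of `1 - b`, then `∏ b ≤ ∏ a`. -/
theorem Finset.prod_le_prod_of_sum_one_sub_pow_le {ι κ : Type*} [Fintype ι] [Fintype κ]
    {a : ι → ℝ} {b : κ → ℝ} (ha : ∀ i, |1 - a i| < 1) (hb : ∀ i, |1 - b i| < 1)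
    {N : ℕ} (h : ∀ n : ℕ, ∑ i, (1 - a i) ^ n ≤ N * ∑ i, (1 - b i) ^ n) :
    ∏ i, b i ^ N ≤ ∏ i, a i := by
  have pos : ∀ {y : ℝ}, |1 - y| < 1 → 0 < y := fun hy => by
    have := (abs_lt.1 hy).2
    linarith
  -- The series `∑ z ^ (n + 1) / (n + 1) = -log (1 - z)` at `z = 1 - a i` sums to `-log (a i)`, so
  -- termwise comparison reverses the order of the products.
  have H1 := hasSum_sum fun i (_ : i ∈ Finset.univ) => Real.hasSum_pow_div_log_of_abs_lt_one (ha i)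
  have H2 := (hasSum_sum fun i (_ : i ∈ Finset.univ) =>
    Real.hasSum_pow_div_log_of_abs_lt_one (hb i)).mul_left (N : ℝ)
  have H := hasSum_le (fun n => ?_) H1 H2
  · simp only [sub_sub_cancel, Finset.sum_neg_distrib] at H
    rw [← Real.log_prod fun i _ => (pos (ha i)).ne', ← Real.log_prod fun i _ => (pos (hb i)).ne']
      at H
    rw [Finset.prod_pow]
    refine (Real.log_le_log_iff (pow_pos (Finset.prod_pos fun i _ => pos (hb i)) _)
      (Finset.prod_pos fun i _ => pos (ha i))).1 ?_
    rw [Real.log_pow]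
    linarith
  · rw [← Finset.sum_div, ← Finset.sum_div, ← mul_div_assoc]
    have := h (n + 1)
    gcongr

theorem prod_add_pow_le_prod_add {ι κ : Type*} [Fintype ι] [Fintype κ] {l : ι → ℝ} {m : κ → ℝ}
    {N : ℕ} (hcard : Fintype.card ι = N * Fintype.card κ) (hl : ∀ i, 0 ≤ l i) (hm : ∀ i, 0 ≤ m i)
    {c₀ : ℝ} (h : ∀ c, c₀ ≤ c → ∀ n : ℕ, ∑ i, (c - l i) ^ n ≤ N * ∑ i, (c - m i) ^ n)
    {t : ℝ} (ht : 0 ≤ t) : ∏ i, (t + m i) ^ N ≤ ∏ i, (t + l i) := by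
  have main : ∀ s : ℝ, 0 < s → ∏ i, (s + m i) ^ N ≤ ∏ i, (s + l i) := fun s hs => by
    -- With `c` above all `l i` and `m i`, the ratios `(c - y) / (c + s)` lie in `[0, 1)`, where the
    -- logarithmic series converges.
    obtain ⟨c, hc0, hc₀, hcl, hcm⟩ : ∃ c, 0 ≤ c ∧ c₀ ≤ c ∧ (∀ i, l i ≤ c) ∧ ∀ i, m i ≤ c := by
      refine ⟨|c₀| + ∑ i, l i + ∑ i, m i, ?_, ?_, fun i => ?_, fun i => ?_⟩ <;>
      have h1 := Finset.sum_nonneg fun i (_ : i ∈ Finset.univ) => hl i <;>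
      have h2 := Finset.sum_nonneg fun i (_ : i ∈ Finset.univ) => hm i <;>
      have h3 := le_abs_self c₀ <;> have h4 := abs_nonneg c₀
      · positivity
      · linarith
      · linarith [Finset.single_le_sum (fun i _ => hl i) (Finset.mem_univ i)]
      · linarith [Finset.single_le_sum (fun i _ => hm i) (Finset.mem_univ i)]
    have hcs : 0 < c + s := by linarith
    have one_sub : ∀ y : ℝ, 1 - (s + y) / (c + s) = (c - y) / (c + s) := fun y => by
      field_simp
      ring
    have bound : ∀ y : ℝ, 0 ≤ y → y ≤ c → |1 - (s + y) / (c + s)| < 1 := fun y hy hyc => by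
      rw [one_sub, abs_of_nonneg (div_nonneg (sub_nonneg.2 hyc) hcs.le), div_lt_one hcs]
      linarith
    have key := Finset.prod_le_prod_of_sum_one_sub_pow_le (N := N)
      (fun i => bound (l i) (hl i) (hcl i)) (fun i => bound (m i) (hm i) (hcm i)) fun n => by
        simp only [one_sub, div_pow, ← Finset.sum_div, ← mul_div_assoc]
        exact div_le_div_of_nonneg_right (h c hc₀ n) (pow_nonneg hcs.le n)
    -- By `hcard` both sides carry the same power of `c + s`.
    simp only [div_pow, Finset.prod_div_distrib, Finset.prod_const, Finset.card_univ, ← pow_mul,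
      hcard] at key
    exact (div_le_div_iff_of_pos_right (pow_pos hcs _)).1 key
  -- At `s = 0` a zero eigenvalue would put the ratio at `1`, so the endpoint is reached by closure.
  have hcont : ∀ {f g : ℝ → ℝ}, Continuous f → Continuous g → (∀ s, 0 < s → f s ≤ g s) →
      f t ≤ g t := fun {f g} hf hg hfg => by
    have : closure (Set.Ioi (0 : ℝ)) ⊆ {s | f s ≤ g s} :=
      closure_minimal (fun s hs => hfg s hs) (isClosed_le hf hg)
    exact this (by simpa using ht)
  exact hcont (f := fun s => ∏ i, (s + m i) ^ N) (g := fun s => ∏ i, (s + l i))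
    (by fun_prop) (by fun_prop) main

open scoped ComplexOrder in
theorem Complex.nonneg_of_two_mul_nonneg {z : ℂ} (h : 0 ≤ 2 * z) : 0 ≤ z := by
  simpa [Complex.nonneg_iff, eq_comm] using h

/-! ### Matrices of the two Laplacians -/

section QuiverLaplacianSpectrum

variable {V : Type*} [Fintype V] [Quiver V] [∀ u v : V, Fintype (u ⟶ v)]

/-- The block matrix of `c - Δ`, where `Δ` is the twisted Laplacian. -/
noncomputable def twistedLaplacianBlocks [DecidableEq V] {N : ℕ} (x : ∀ ⦃u v : V⦄, (u ⟶ v) → ℝ)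
    (U : ∀ ⦃u v : V⦄, (u ⟶ v) → Matrix (Fin N) (Fin N) ℂ) (c : ℝ) :
    Matrix V V (Matrix (Fin N) (Fin N) ℂ) :=
  of fun u v => (if u = v then ((c - ∑ w : V, ∑ e : u ⟶ w, x e : ℝ) : ℂ) else 0) • 1 +
    ∑ e : u ⟶ v, (x e : ℂ) • U e

/-- The real matrix of `c - Δ₀`, where `Δ₀` is the scalar Laplacian. -/
noncomputable def scalarLaplacianBlocks [DecidableEq V] (x : ∀ ⦃u v : V⦄, (u ⟶ v) → ℝ) (c : ℝ) :
    Matrix V V ℝ :=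
  of fun u v => (if u = v then c - ∑ w : V, ∑ e : u ⟶ w, x e else 0) + ∑ e : u ⟶ v, x e

variable {N : ℕ} {x : ∀ ⦃u v : V⦄, (u ⟶ v) → ℝ}
  {U : ∀ ⦃u v : V⦄, (u ⟶ v) → Matrix (Fin N) (Fin N) ℂ}

section Domination
open scoped Matrix.Norms.L2Operator

/-- Unitaries have norm at most one, and `hc` makes the diagonal coefficient non-negative, hence
equal to its absolute value. -/
theorem norm_twistedLaplacianBlocks_le [DecidableEq V] (hx : ∀ ⦃u v : V⦄ (e : u ⟶ v), 0 ≤ x e)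
    (hU : ∀ ⦃u v : V⦄ (e : u ⟶ v), U e ∈ unitaryGroup (Fin N) ℂ) {c : ℝ}
    (hc : ∀ u : V, ∑ w : V, ∑ e : u ⟶ w, x e ≤ c) (u v : V) :
    ‖twistedLaplacianBlocks x U c u v‖ ≤ scalarLaplacianBlocks x c u v := by
  have h1 : ∀ M ∈ unitaryGroup (Fin N) ℂ, ‖M‖ ≤ 1 := fun M hM => by
    -- For `N = 0` the matrix ring is trivial and unitaries have norm `0`, not `1`.
    obtain h | h := subsingleton_or_nontrivial (Matrix (Fin N) (Fin N) ℂ)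
    · rw [Subsingleton.elim M 0]
      simp
    · exact (CStarRing.norm_of_mem_unitary hM).le
  refine (norm_add_le _ _).trans (add_le_add ?_ ((norm_sum_le _ _).trans
    (Finset.sum_le_sum fun e _ => ?_)))
  · have h2 := h1 1 (one_mem _)
    split_ifs with huv
    · rw [norm_smul, Complex.norm_real, Real.norm_of_nonneg (sub_nonneg.2 (hc u))]
      exact mul_le_of_le_one_right (sub_nonneg.2 (hc u)) h2
    · simp
  · rw [norm_smul, Complex.norm_real, Real.norm_of_nonneg (hx e)]
    exact mul_le_of_le_one_right (hx e) (h1 _ (hU e))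

end Domination

/-- The matrix of the twisted Laplacian. -/
noncomputable def twistedLaplacianMatrix [DecidableEq V] (x : ∀ ⦃u v : V⦄, (u ⟶ v) → ℝ)
    (U : ∀ ⦃u v : V⦄, (u ⟶ v) → Matrix (Fin N) (Fin N) ℂ) :
    Matrix (V × Fin N) (V × Fin N) ℂ :=
  -comp V V (Fin N) (Fin N) ℂ (twistedLaplacianBlocks x U 0)

/-- The matrix of the scalar Laplacian. -/
noncomputable def scalarLaplacianMatrix [DecidableEq V] (x : ∀ ⦃u v : V⦄, (u ⟶ v) → ℝ) :
    Matrix V V ℂ :=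
  -(scalarLaplacianBlocks x 0).map Complex.ofReal

theorem smul_one_sub_twistedLaplacianMatrix [DecidableEq V] (c : ℝ) :
    (c : ℂ) • 1 - twistedLaplacianMatrix x U =
      comp V V (Fin N) (Fin N) ℂ (twistedLaplacianBlocks x U c) := by
  ext ⟨u, i⟩ ⟨v, j⟩
  by_cases huv : u = v <;> by_cases hij : i = j <;>
  simp [twistedLaplacianMatrix, twistedLaplacianBlocks, comp_apply, huv, hij, one_apply]
  ring

theorem smul_one_sub_scalarLaplacianMatrix [DecidableEq V] (c : ℝ) :
    (c : ℂ) • 1 - scalarLaplacianMatrix x = (scalarLaplacianBlocks x c).map Complex.ofReal := by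
  ext u v
  by_cases huv : u = v <;>
  simp [scalarLaplacianMatrix, scalarLaplacianBlocks, huv, one_apply]
  ring

theorem twistedLaplacianMatrix_mulVec [DecidableEq V] (f : V → Fin N → ℂ) :
    twistedLaplacianMatrix x U *ᵥ Function.uncurry f =
      Function.uncurry (twistedLaplacian x U f) := by
  ext ⟨u, i⟩
  have h : ∀ v, ∑ j, twistedLaplacianMatrix x U (u, i) (v, j) * f v j =
      (if u = v then (∑ w : V, ∑ e : u ⟶ w, (x e : ℂ)) * f v i else 0) -
        ∑ e : u ⟶ v, (x e : ℂ) * (U e *ᵥ f v) i := fun v => by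
    have h1 : ∑ e : u ⟶ v, (x e : ℂ) * (U e *ᵥ f v) i =
        ∑ j, (∑ e : u ⟶ v, (x e : ℂ) * U e i j) * f v j := by
      simp only [mulVec, dotProduct, Finset.mul_sum, Finset.sum_mul, mul_assoc]
      rw [Finset.sum_comm]
    rw [h1]
    by_cases huv : u = v
    · subst huv
      simp [twistedLaplacianMatrix, twistedLaplacianBlocks, comp_apply, one_apply,
        Matrix.sum_apply, add_mul, Finset.sum_add_distrib]
      ring
    · simp [twistedLaplacianMatrix, twistedLaplacianBlocks, comp_apply, huv,
        Matrix.sum_apply]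
  simp only [mulVec, dotProduct, Fintype.sum_prod_type, Function.uncurry_apply_pair, h]
  simp [twistedLaplacian, mul_sub, Finset.sum_sub_distrib, Finset.sum_mul, mulVec, dotProduct]

theorem scalarLaplacianMatrix_mulVec [DecidableEq V] (f : V → ℂ) :
    scalarLaplacianMatrix x *ᵥ f = scalarLaplacian x f := by
  ext u
  have h : ∀ v, scalarLaplacianMatrix x u v * f v =
      (if u = v then (∑ w : V, ∑ e : u ⟶ w, (x e : ℂ)) * f v else 0) -
        ∑ e : u ⟶ v, (x e : ℂ) * f v := fun v => by
    rw [← Finset.sum_mul]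
    by_cases huv : u = v
    · subst huv
      simp [scalarLaplacianMatrix, scalarLaplacianBlocks]
      ring
    · simp [scalarLaplacianMatrix, scalarLaplacianBlocks, huv]
  simp only [mulVec, dotProduct, h]
  simp [scalarLaplacian, mul_sub, Finset.sum_sub_distrib, Finset.sum_mul]

/-- Conjugation by currying transfers characteristic polynomial and determinant to the matrix. -/
theorem curry_conj_twistedLaplacian [DecidableEq V] :
    (LinearEquiv.curry ℂ ℂ V (Fin N)).symm.conj (twistedLaplacian x U) =
      toLin' (twistedLaplacianMatrix x U) := by
  ext1 g
  ext1
  simp only [LinearMap.comp_apply, LinearEquiv.conj_apply, LinearEquiv.coe_coe,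
    LinearEquiv.symm_symm, toLin'_apply]
  generalize LinearMap.single ℂ (fun _ => ℂ) g 1 = f
  exact (twistedLaplacianMatrix_mulVec (Function.curry f)).symm

theorem charpoly_twistedLaplacian [DecidableEq V] :
    (twistedLaplacian x U).charpoly = (twistedLaplacianMatrix x U).charpoly := by
  rw [← LinearEquiv.charpoly_conj (LinearEquiv.curry ℂ ℂ V (Fin N)).symm,
    curry_conj_twistedLaplacian, charpoly_toLin']

theorem det_smul_id_add_twistedLaplacian [DecidableEq V] (t : ℂ) :
    LinearMap.det (t • LinearMap.id + twistedLaplacian x U) =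
      (t • 1 + twistedLaplacianMatrix x U).det := by
  rw [← LinearMap.det_conj _ (LinearEquiv.curry ℂ ℂ V (Fin N)).symm, ← LinearMap.det_toLin',
    map_add, ← curry_conj_twistedLaplacian, map_smul, toLin'_one]
  congr 1

theorem toLin'_scalarLaplacianMatrix [DecidableEq V] :
    toLin' (scalarLaplacianMatrix x) = scalarLaplacian x :=
  LinearMap.ext fun f => scalarLaplacianMatrix_mulVec f

theorem charpoly_scalarLaplacian [DecidableEq V] :
    (scalarLaplacian x).charpoly = (scalarLaplacianMatrix x).charpoly := by
  rw [← toLin'_scalarLaplacianMatrix, charpoly_toLin']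

theorem det_smul_id_add_scalarLaplacian [DecidableEq V] (t : ℂ) :
    LinearMap.det (t • LinearMap.id + scalarLaplacian x) =
      (t • 1 + scalarLaplacianMatrix x).det := by
  have h : toLin' (t • 1 + scalarLaplacianMatrix x) = t • LinearMap.id + scalarLaplacian x := by
    rw [map_add, toLin'_scalarLaplacianMatrix, map_smul, toLin'_one]
  rw [← h, LinearMap.det_toLin']

/-! ### Edge reversal, symmetry and Dirichlet energy -/

variable [Quiver.HasInvolutiveReverse V]

/-- Reversal of edges as an equivalence. -/
def Quiver.reverseEquiv (u v : V) : (u ⟶ v) ≃ (v ⟶ u) where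
  toFun := Quiver.reverse
  invFun := Quiver.reverse
  left_inv := Quiver.reverse_reverse
  right_inv := Quiver.reverse_reverse

theorem Quiver.sum_edges_reverse {M : Type*} [AddCommMonoid M]
    (F : ∀ u v : V, (u ⟶ v) → M) :
    ∑ u, ∑ v, ∑ e : u ⟶ v, F u v e = ∑ u, ∑ v, ∑ e : u ⟶ v, F v u (Quiver.reverse e) := by
  rw [Finset.sum_comm]
  exact Finset.sum_congr rfl fun u _ => Finset.sum_congr rfl fun v _ =>
    (Equiv.sum_comp (Quiver.reverseEquiv u v) _).symm

theorem isHermitian_twistedLaplacianMatrix [DecidableEq V]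
    (hx : ∀ ⦃u v : V⦄ (e : u ⟶ v), x (Quiver.reverse e) = x e)
    (hU : ∀ ⦃u v : V⦄ (e : u ⟶ v), U (Quiver.reverse e) = (U e)ᴴ) :
    (twistedLaplacianMatrix x U).IsHermitian := by
  refine IsHermitian.neg (IsHermitian.ext ?_)
  rintro ⟨u, i⟩ ⟨v, j⟩
  have h : ∑ e : v ⟶ u, (x e : ℂ) * star (U e j i) = ∑ e : u ⟶ v, (x e : ℂ) * U e i j := by
    rw [← Equiv.sum_comp (Quiver.reverseEquiv u v)]
    refine Finset.sum_congr rfl fun e _ => ?_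
    simp [Quiver.reverseEquiv, hx, hU]
  by_cases huv : u = v
  · subst huv
    by_cases hij : i = j
    · subst hij
      simpa [twistedLaplacianBlocks, comp_apply, Matrix.sum_apply] using h
    · simpa [twistedLaplacianBlocks, comp_apply, Matrix.sum_apply, one_apply, hij, Ne.symm hij,
        eq_comm] using h
  · simpa [twistedLaplacianBlocks, comp_apply, Matrix.sum_apply, huv, Ne.symm huv] using h

theorem isHermitian_scalarLaplacianMatrix [DecidableEq V]
    (hx : ∀ ⦃u v : V⦄ (e : u ⟶ v), x (Quiver.reverse e) = x e) :
    (scalarLaplacianMatrix x).IsHermitian := by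
  refine IsHermitian.neg (IsHermitian.ext fun u v => ?_)
  have h : ∑ e : v ⟶ u, (x e : ℂ) = ∑ e : u ⟶ v, (x e : ℂ) := by
    rw [← Equiv.sum_comp (Quiver.reverseEquiv u v)]
    refine Finset.sum_congr rfl fun e _ => ?_
    simp [Quiver.reverseEquiv, hx]
  by_cases huv : u = v
  · subst huv
    simp [scalarLaplacianBlocks]
  · simpa [scalarLaplacianBlocks, huv, Ne.symm huv] using h

/-- The Dirichlet energy of the twisted Laplacian. -/
theorem two_mul_sum_dotProduct_twistedLaplacian
    (hx : ∀ ⦃u v : V⦄ (e : u ⟶ v), x (Quiver.reverse e) = x e)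
    (hU : ∀ ⦃u v : V⦄ (e : u ⟶ v), U (Quiver.reverse e) = (U e)ᴴ)
    (hunit : ∀ ⦃u v : V⦄ (e : u ⟶ v), U e ∈ unitaryGroup (Fin N) ℂ) (f : V → Fin N → ℂ) :
    2 * ∑ u, star (f u) ⬝ᵥ twistedLaplacian x U f u =
      ∑ u, ∑ v, ∑ e : u ⟶ v,
        (x e : ℂ) * (star (f u - U e *ᵥ f v) ⬝ᵥ (f u - U e *ᵥ f v)) := by
  have h : ∑ u, star (f u) ⬝ᵥ twistedLaplacian x U f u =
      ∑ u, ∑ v, ∑ e : u ⟶ v, (x e : ℂ) * (star (f u) ⬝ᵥ (f u - U e *ᵥ f v)) := by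
    simp only [twistedLaplacian, LinearMap.coe_mk, AddHom.coe_mk, dotProduct_sum, dotProduct_smul,
      smul_eq_mul]
  rw [two_mul]
  -- One of the two copies is summed over reversed edges; by unitarity the terms of `e` and its
  -- reverse then complete a square.
  nth_rw 2 [h]
  rw [Quiver.sum_edges_reverse, h]
  simp only [← Finset.sum_add_distrib]
  refine Finset.sum_congr rfl fun u _ => Finset.sum_congr rfl fun v _ =>
    Finset.sum_congr rfl fun e _ => ?_
  rw [hx, hU, ← mul_add]
  congr 1
  have h1 : star (U e *ᵥ f v) ⬝ᵥ f u = star (f v) ⬝ᵥ ((U e)ᴴ *ᵥ f u) := by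
    rw [star_mulVec, dotProduct_mulVec]
  have h2 : star (U e *ᵥ f v) ⬝ᵥ (U e *ᵥ f v) = star (f v) ⬝ᵥ f v := by
    rw [star_mulVec, ← dotProduct_mulVec, mulVec_mulVec, ← star_eq_conjTranspose,
      mem_unitaryGroup_iff'.1 (hunit e), one_mulVec]
  rw [star_sub, sub_dotProduct, dotProduct_sub, dotProduct_sub, dotProduct_sub, h1, h2]
  ring

open scoped ComplexOrder


theorem posSemidef_twistedLaplacianMatrix [DecidableEq V]
    (hxpos : ∀ ⦃u v : V⦄ (e : u ⟶ v), 0 ≤ x e)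
    (hx : ∀ ⦃u v : V⦄ (e : u ⟶ v), x (Quiver.reverse e) = x e)
    (hU : ∀ ⦃u v : V⦄ (e : u ⟶ v), U (Quiver.reverse e) = (U e)ᴴ)
    (hunit : ∀ ⦃u v : V⦄ (e : u ⟶ v), U e ∈ unitaryGroup (Fin N) ℂ) :
    (twistedLaplacianMatrix x U).PosSemidef := by
  refine PosSemidef.of_dotProduct_mulVec_nonneg (isHermitian_twistedLaplacianMatrix hx hU)
    fun f => ?_
  have h := two_mul_sum_dotProduct_twistedLaplacian hx hU hunit (Function.curry f)
  have h0 : (0 : ℂ) ≤ 2 * ∑ u, star (Function.curry f u) ⬝ᵥ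
      twistedLaplacian x U (Function.curry f) u := by
    rw [h]
    exact Finset.sum_nonneg fun u _ => Finset.sum_nonneg fun v _ => Finset.sum_nonneg fun e _ =>
      mul_nonneg (by simpa using hxpos e) (dotProduct_star_self_nonneg _)
  rw [← Function.uncurry_curry f, twistedLaplacianMatrix_mulVec]
  have h1 := Complex.nonneg_of_two_mul_nonneg h0
  simpa [dotProduct, Fintype.sum_prod_type] using h1

theorem eigenvalues_twistedLaplacianMatrix_nonneg [DecidableEq V]
    (hxpos : ∀ ⦃u v : V⦄ (e : u ⟶ v), 0 ≤ x e)
    (hx : ∀ ⦃u v : V⦄ (e : u ⟶ v), x (Quiver.reverse e) = x e)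
    (hU : ∀ ⦃u v : V⦄ (e : u ⟶ v), U (Quiver.reverse e) = (U e)ᴴ)
    (hunit : ∀ ⦃u v : V⦄ (e : u ⟶ v), U e ∈ unitaryGroup (Fin N) ℂ)
    (hA : (twistedLaplacianMatrix x U).IsHermitian) (i : V × Fin N) : 0 ≤ hA.eigenvalues i :=
  (posSemidef_twistedLaplacianMatrix hxpos hx hU hunit).eigenvalues_nonneg i

/-- The Dirichlet energy of the scalar Laplacian. -/
theorem two_mul_dotProduct_scalarLaplacian
    (hx : ∀ ⦃u v : V⦄ (e : u ⟶ v), x (Quiver.reverse e) = x e) (g : V → ℂ) :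
    2 * (star g ⬝ᵥ scalarLaplacian x g) =
      ∑ u, ∑ v, ∑ e : u ⟶ v, (x e : ℂ) * (star (g u - g v) * (g u - g v)) := by
  -- The scalar Laplacian is the twisted one for the trivial rank-one representation.
  have h := two_mul_sum_dotProduct_twistedLaplacian (N := 1) (U := fun _ _ _ => 1) hx
    (by simp) (fun _ _ _ => one_mem _) (fun u _ => g u)
  simpa [twistedLaplacian, scalarLaplacian, dotProduct] using h

theorem posSemidef_scalarLaplacianMatrix [DecidableEq V]
    (hxpos : ∀ ⦃u v : V⦄ (e : u ⟶ v), 0 ≤ x e)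
    (hx : ∀ ⦃u v : V⦄ (e : u ⟶ v), x (Quiver.reverse e) = x e) :
    (scalarLaplacianMatrix x).PosSemidef := by
  refine PosSemidef.of_dotProduct_mulVec_nonneg (isHermitian_scalarLaplacianMatrix hx)
    fun g => ?_
  refine Complex.nonneg_of_two_mul_nonneg ?_
  rw [scalarLaplacianMatrix_mulVec, two_mul_dotProduct_scalarLaplacian hx]
  exact Finset.sum_nonneg fun u _ => Finset.sum_nonneg fun v _ => Finset.sum_nonneg fun e _ =>
    mul_nonneg (by simpa using hxpos e) (star_mul_self_nonneg _)

theorem eigenvalues_scalarLaplacianMatrix_nonneg [DecidableEq V]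
    (hxpos : ∀ ⦃u v : V⦄ (e : u ⟶ v), 0 ≤ x e)
    (hx : ∀ ⦃u v : V⦄ (e : u ⟶ v), x (Quiver.reverse e) = x e)
    (hA : (scalarLaplacianMatrix x).IsHermitian) (i : V) : 0 ≤ hA.eigenvalues i :=
  (posSemidef_scalarLaplacianMatrix hxpos hx).eigenvalues_nonneg i

/-! ### Kernel of the scalar Laplacian -/

/-- Harmonic functions on a connected quiver are constant. -/
theorem eq_of_scalarLaplacian_eq_zero (hconn : Quiver.IsStronglyConnected V)
    (hxpos : ∀ ⦃u v : V⦄ (e : u ⟶ v), 0 < x e)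
    (hx : ∀ ⦃u v : V⦄ (e : u ⟶ v), x (Quiver.reverse e) = x e) {g : V → ℂ}
    (hg : scalarLaplacian x g = 0) (u v : V) : g u = g v := by
  have h := two_mul_dotProduct_scalarLaplacian hx g
  have nonneg : ∀ u v : V, ∀ e : u ⟶ v, 0 ≤ (x e : ℂ) * (star (g u - g v) * (g u - g v)) :=
    fun u v e => mul_nonneg (by simpa using (hxpos e).le) (star_mul_self_nonneg _)
  rw [hg, dotProduct_zero, mul_zero, eq_comm, Finset.sum_eq_zero_iff_of_nonneg fun u _ =>
    Finset.sum_nonneg fun v _ => Finset.sum_nonneg fun e _ => nonneg u v e] at h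
  have edge : ∀ ⦃u v : V⦄, (u ⟶ v) → g u = g v := fun u v e => by
    have h1 := h u (Finset.mem_univ u)
    rw [Finset.sum_eq_zero_iff_of_nonneg fun v _ => Finset.sum_nonneg fun e _ => nonneg u v e] at h1
    have h2 := h1 v (Finset.mem_univ v)
    rw [Finset.sum_eq_zero_iff_of_nonneg fun e _ => nonneg u v e] at h2
    have h3 := h2 e (Finset.mem_univ e)
    have h4 : g u - g v = 0 := by simpa [(hxpos e).ne', -star_sub, -map_sub] using h3
    exact sub_eq_zero.1 h4
  obtain ⟨p⟩ := hconn u v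
  induction p with
  | nil => rfl
  | cons _ e ih => exact ih.trans (edge e)

/-- Constants are harmonic, so zero is an eigenvalue. Two null vectors of an eigenbasis would be
non-zero constants, which cannot be orthogonal. -/
theorem existsUnique_eigenvalues_scalarLaplacianMatrix_eq_zero [DecidableEq V] [Nonempty V]
    (hconn : Quiver.IsStronglyConnected V) (hxpos : ∀ ⦃u v : V⦄ (e : u ⟶ v), 0 < x e)
    (hx : ∀ ⦃u v : V⦄ (e : u ⟶ v), x (Quiver.reverse e) = x e)
    (hA : (scalarLaplacianMatrix x).IsHermitian) : ∃! i, hA.eigenvalues i = 0 := by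
  have hdet : (scalarLaplacianMatrix x).det = 0 := by
    refine exists_mulVec_eq_zero_iff.1 ⟨1, one_ne_zero, ?_⟩
    rw [scalarLaplacianMatrix_mulVec]
    ext u
    simp [scalarLaplacian]
  rw [hA.det_eq_prod_eigenvalues, Finset.prod_eq_zero_iff] at hdet
  obtain ⟨i, -, hi⟩ := hdet
  refine ⟨i, by simpa using hi, fun j hj => ?_⟩
  have const : ∀ k, hA.eigenvalues k = 0 → ∀ u v, hA.eigenvectorBasis k u =
      hA.eigenvectorBasis k v := fun k hk => by
    refine eq_of_scalarLaplacian_eq_zero hconn hxpos hx ?_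
    rw [← scalarLaplacianMatrix_mulVec, hA.mulVec_eigenvectorBasis, hk, zero_smul]
  obtain ⟨v⟩ := ‹Nonempty V›
  have ne : ∀ k, hA.eigenvalues k = 0 → hA.eigenvectorBasis k v ≠ 0 := fun k hk h0 =>
    hA.eigenvectorBasis.orthonormal.ne_zero k <| PiLp.ext fun u => by
      rw [const k hk u v, h0, PiLp.zero_apply]
  by_contra hji
  have h := hA.eigenvectorBasis.orthonormal.2 hji
  simp only [PiLp.inner_apply, const j hj _ v, const i (by simpa using hi) _ v] at h
  simp [ne j hj, ne i (by simpa using hi)] at h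

end QuiverLaplacianSpectrum

/-! ### The determinant inequality -/

theorem mainTheorem9 {V : Type*} [Fintype V] [Nonempty V]
    [Quiver V] [∀ u v : V, Fintype (u ⟶ v)]
    -- bidirected: a fixed-point free involution on the edges which exchanges source and target
    [Quiver.HasInvolutiveReverse V]
    (hfree : ∀ (v : V) (e : v ⟶ v), Quiver.reverse e ≠ e)
    (hconn : Quiver.IsStronglyConnected V)
    (x : ∀ ⦃u v : V⦄, (u ⟶ v) → ℝ)
    (hxpos : ∀ ⦃u v : V⦄ (e : u ⟶ v), 0 < x e)
    (hxsymm : ∀ ⦃u v : V⦄ (e : u ⟶ v), x (Quiver.reverse e) = x e)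
    (N : ℕ)
    (U : ∀ ⦃u v : V⦄, (u ⟶ v) → Matrix.unitaryGroup (Fin N) ℂ)
    (hU : ∀ ⦃u v : V⦄ (e : u ⟶ v), U (Quiver.reverse e) = (U e)⁻¹) :
    ∃ (lam : Fin (N * Fintype.card V) → ℝ) (mu : Fin (Fintype.card V) → ℝ),
      IsOrderedSpectrum
          (twistedLaplacian x (fun _ _ e => (U e : Matrix (Fin N) (Fin N) ℂ))) lam ∧
      (∀ i, 0 ≤ lam i) ∧
      IsOrderedSpectrum (scalarLaplacian x) mu ∧
      (∀ i, 0 ≤ mu i) ∧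
      -- `mu` vanishes exactly at the last index
      (∀ i, mu i = 0 ↔ (i : ℕ) + 1 = Fintype.card V) ∧
      ∀ t : ℝ, 0 ≤ t →
        LinearMap.det ((t : ℂ) • LinearMap.id +
            twistedLaplacian x (fun _ _ e => (U e : Matrix (Fin N) (Fin N) ℂ))) =
          ((∏ i, (t + lam i) : ℝ) : ℂ) ∧
        ∏ i, (t + lam i) ≥ ∏ i, (t + mu i) ^ N ∧
        ((∏ i, (t + mu i) ^ N : ℝ) : ℂ) =
          LinearMap.det ((t : ℂ) • LinearMap.id + scalarLaplacian x) ^ N := by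
  classical
  have hxnn : ∀ ⦃u v : V⦄ (e : u ⟶ v), 0 ≤ x e := fun _ _ e => (hxpos e).le
  have hU' : ∀ ⦃u v : V⦄ (e : u ⟶ v),
      (U (Quiver.reverse e) : Matrix (Fin N) (Fin N) ℂ) = (U e : Matrix (Fin N) (Fin N) ℂ)ᴴ :=
    fun u v e => by
      rw [hU]
      rfl
  have hunit : ∀ ⦃u v : V⦄ (e : u ⟶ v),
      (U e : Matrix (Fin N) (Fin N) ℂ) ∈ unitaryGroup (Fin N) ℂ := fun _ _ e => (U e).2
  have hA := isHermitian_twistedLaplacianMatrix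
    (U := fun _ _ e => (U e : Matrix (Fin N) (Fin N) ℂ)) hxsymm hU'
  have hA0 := isHermitian_scalarLaplacianMatrix hxsymm
  obtain ⟨lam, e, hlam, hlamS⟩ := hA.exists_isOrderedSpectrum
    (n := N * Fintype.card V) (by simp [mul_comm]) charpoly_twistedLaplacian
  obtain ⟨mu, e0, hmu, hmuS⟩ := hA0.exists_isOrderedSpectrum rfl
    charpoly_scalarLaplacian
  have hlam0 : ∀ i, 0 ≤ lam i := fun i => hlam i ▸
    eigenvalues_twistedLaplacianMatrix_nonneg hxnn hxsymm hU' hunit hA _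
  have hmu0 : ∀ i, 0 ≤ mu i := fun i => hmu i ▸
    eigenvalues_scalarLaplacianMatrix_nonneg hxnn hxsymm hA0 _
  refine ⟨lam, mu, hlamS, hlam0, hmuS, hmu0, fun i => ?_, fun t ht => ⟨?_, ?_, ?_⟩⟩
  · obtain ⟨k, hk, hku⟩ := existsUnique_eigenvalues_scalarLaplacianMatrix_eq_zero hconn hxpos
      hxsymm hA0
    have hcard := Fintype.card_pos (α := V)
    have uniq : ∀ j, mu j = 0 ↔ j = e0.symm k := fun j => by
      rw [hmu, Equiv.eq_symm_apply]
      exact ⟨hku _, fun h => h ▸ hk⟩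
    -- As `mu` is antitone and non-negative, its value at the last index is squeezed to zero.
    have hlast : mu ⟨Fintype.card V - 1, by omega⟩ = 0 := by
      refine le_antisymm (((uniq _).2 rfl).symm ▸ hmuS.1 (?_ : e0.symm k ≤ _)) (hmu0 _)
      have := (e0.symm k).2
      simp only [Fin.le_def]
      omega
    rw [uniq, ← (uniq _).1 hlast, Fin.ext_iff]
    simp only
    omega
  · rw [det_smul_id_add_twistedLaplacian, hA.det_smul_one_add, ← Equiv.prod_comp e]
    simp only [hlam]
  -- The total weight `c₀` bounds every weighted degree.
  · refine prod_add_pow_le_prod_add (by simp) hlam0 hmu0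
      (c₀ := ∑ u : V, ∑ w : V, ∑ e : u ⟶ w, x e) (fun c hc n => ?_) ht
    have hdeg : ∀ u : V, ∑ w : V, ∑ e : u ⟶ w, x e ≤ c := fun u =>
      (Finset.single_le_sum (f := fun u : V => ∑ w : V, ∑ e : u ⟶ w, x e)
        (fun u _ => Finset.sum_nonneg fun w _ => Finset.sum_nonneg fun e _ => hxnn e)
        (Finset.mem_univ u)).trans hc
    have key := norm_trace_comp_pow_le (norm_twistedLaplacianBlocks_le hxnn hunit hdeg) n
    have h0 : (((scalarLaplacianBlocks x c ^ n).trace : ℝ) : ℂ) =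
        (((c : ℂ) • 1 - scalarLaplacianMatrix x) ^ n).trace := by
      rw [smul_one_sub_scalarLaplacianMatrix]
      have := (scalarLaplacianBlocks x c).map_pow Complex.ofRealHom n
      exact (AddMonoidHom.map_trace Complex.ofRealHom.toAddMonoidHom _).trans (congrArg trace this)
    rw [hA0.trace_smul_one_sub_pow, Complex.ofReal_inj] at h0
    rw [← smul_one_sub_twistedLaplacianMatrix, hA.trace_smul_one_sub_pow, h0,
      Complex.norm_real, Fintype.card_fin] at key
    simp only [hlam, hmu]
    rw [Equiv.sum_comp e fun i => (c - hA.eigenvalues i) ^ n,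
      Equiv.sum_comp e0 fun i => (c - hA0.eigenvalues i) ^ n]
    exact (le_abs_self _).trans key
  · rw [det_smul_id_add_scalarLaplacian, hA0.det_smul_one_add, ← Equiv.prod_comp e0,
      Finset.prod_pow]
    simp only [hmu]
    push_cast
    rfl
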